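/- Let $\rho>0$, $\beta>\rho$ and $\xi>0$. A line starting at a source has a random length $L$ that is exponentially distributed with mean $1/\beta$. Relays are placed sequentially while walking along the line. The process has states in $(0,1]$, together with a termination state $\mathbf e$ (the line has ended), in which no further cost is incurred. At the $k$-th decision instant ($k=0,1,2,\dots$), in state $s_k\in(0,1]$ at location $y_k$ (with $y_0=0$), an action $a_k\in[0,\infty]$ is chosen as a measurable function of the locations $y_0,\dots,y_k$; a policy $\pi$ is a sequence of such functions. Let $l_k=L-y_k$ be the residual length. If $l_k>a_k$, a relay is placed at $y_{k+1}=y_k+a_k$, the cost $\xi+s_k(e^{\rho a_k}-1)$ is incurred, and the next state is $s_{k+1}=\dfrac{s_ke^{\rho a_k}}{1+s_ke^{\rho a_k}}$. If $l_k\le a_k$ (in particular if $a_k=\infty$), the line ends, the cost $s_k(e^{\rho l_k}-1)$ is incurred, and $s_{k+1}=\mathbf e$. For $s\in(0,1]$ let $$J_\xi(s)=\inf_{\pi}\ \mathbb E_\pi\Big(\sum_{k=0}^\infty c_k\ \Big|\ s_0=s\Big)\in[0,\infty],$$ where $c_k$ is the cost incurred at the $k$-th instant. Let $\theta=\dfrac{\rho}{\beta-\rho}$.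 Then $J_\xi(s)<\theta s$ for every $s\in(0,1]$, and consequently $J_\xi(s)\to 0$ as $s\to0$ (with $s\in(0,1]$). -/

import Mathlib

open Filter Topology MeasureTheory ProbabilityTheory
open scoped ENNReal

noncomputable section

namespace RelayPlacement

/-- The states `(0, 1]` of the process while the line has not yet ended. -/
abbrev ActiveState : Type := Set.Ioc (0 : ℝ) 1

/-- The state space `(0, 1] ∪ {𝐞}`; `ended` is the termination state `𝐞` (the line has ended). -/
inductive State : Type where
  | active (s : ActiveState) : State
  | ended : State

/-- The new active state `s e^{ρ a} / (1 + s e^{ρ a})` after a relay has been placed at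
distance `a` from the current position. -/
def nextActive (ρ : ℝ) (s : ActiveState) (a : ℝ) : ActiveState :=
  ⟨s.1 * Real.exp (ρ * a) / (1 + s.1 * Real.exp (ρ * a)), by
    have h : 0 < s.1 * Real.exp (ρ * a) := mul_pos s.2.1 (Real.exp_pos _)
    exact ⟨by positivity, (div_le_one (by positivity)).2 (by linarith)⟩⟩

/-- State transition for action `a ∈ [0, ∞]` (`a = ∞`: no further relay is placed) and residual
line length `l`: a relay is placed if `a < l`, otherwise the line ends. -/
def nextState (ρ : ℝ) : State → ℝ≥0∞ → ℝ → State
  | .active s, a, l => if a < ENNReal.ofReal l then .active (nextActive ρ s a.toReal) else .ended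
  | .ended, _, _ => .ended

/-- Single-stage cost `c(s, a, l)`: `ξ + s (e^{ρ a} - 1)` if `l > a`, and `s (e^{ρ l} - 1)` if
`l ≤ a`; it is `0` in the termination state. -/
def stageCost (ρ ξ : ℝ) : State → ℝ≥0∞ → ℝ → ℝ
  | .active s, a, l =>
      if a < ENNReal.ofReal l then ξ + s.1 * (Real.exp (ρ * a.toReal) - 1)
      else s.1 * (Real.exp (ρ * l) - 1)
  | .ended, _, _ => 0

/-- A deployment policy: at the decision instant `k`, it prescribes, as a measurable function of
the locations `y 0 = 0, y 1, …, y k` of the starting point and of the relays placed so far, the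
distance in `[0, ∞]` from `y k` at which the next relay is to be placed. -/
structure Policy : Type where
  μ : (k : ℕ) → (Fin (k + 1) → ℝ) → ℝ≥0∞
  measurable_μ : ∀ k, Measurable (μ k)

/-- The situation at the decision instant `k`: the state, and the locations `y 0, …, y k`.
The locations carry no meaning once the state is `ended`. -/
structure Config (k : ℕ) : Type where
  state : State
  y : Fin (k + 1) → ℝ

/-- The action that the policy prescribes in a given situation. -/
def Config.action {k : ℕ} (c : Config k) (π : Policy) : ℝ≥0∞ := π.μ k c.y

/-- The residual length `ℓ - y k` of a line of length `ℓ`. -/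
def Config.residual {k : ℕ} (c : Config k) (ℓ : ℝ) : ℝ := ℓ - c.y (Fin.last k)

/-- The trajectory under the policy `π` from the state `s` at location `0`, on a line of
length `ℓ`. -/
def trajectory (ρ : ℝ) (π : Policy) (s : ActiveState) (ℓ : ℝ) : (k : ℕ) → Config k
  | 0 => ⟨.active s, fun _ => 0⟩
  | k + 1 =>
      let c := trajectory ρ π s ℓ k
      ⟨nextState ρ c.state (c.action π) (c.residual ℓ),
        Fin.snoc (α := fun _ => ℝ) c.y (c.y (Fin.last k) + (c.action π).toReal)⟩

/-- The total cost over the infinite horizon, on a line of length `ℓ`. -/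
def totalCost (ρ ξ : ℝ) (π : Policy) (s : ActiveState) (ℓ : ℝ) : ℝ≥0∞ :=
  ∑' k : ℕ, ENNReal.ofReal
    (stageCost ρ ξ (trajectory ρ π s ℓ k).state ((trajectory ρ π s ℓ k).action π)
      ((trajectory ρ π s ℓ k).residual ℓ))

/-- The expected total cost, the line length being exponential with mean `1 / β`. -/
def expectedCost (ρ β ξ : ℝ) (π : Policy) (s : ActiveState) : ℝ≥0∞ :=
  ∫⁻ ℓ, totalCost ρ ξ π s ℓ ∂(expMeasure β)

/-- The optimal value function `J_ξ(s)`. -/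
def optimalValue (ρ β ξ : ℝ) (s : ActiveState) : ℝ≥0∞ :=
  ⨅ π : Policy, expectedCost ρ β ξ π s

end RelayPlacement

end

/-! With θ = ρ/(β-ρ), placing no relay costs θs on average. Compare this with one relay at distance
a and none after. The line outlives a with probability e^{-βa}, and then an expected remaining cost
θse^{ρa} is replaced by ξ + θs', where s' ≤ 1 is the new state. The mean is thus θs -
e^{-βa}(θ(se^{ρa} - s') - ξ) (`expectedCost_singleRelayPolicy`), and the bracket is positive once a
is large. The limit follows by squeezing. -/

namespace RelayPlacement

/-- The policy that places one relay at distance `a` from the starting point, and none after. -/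
def singleRelayPolicy (a : ℝ) : Policy where
  μ k _ := if k = 0 then ENNReal.ofReal a else ∞
  measurable_μ _ := measurable_const

/-- The total cost of placing a single relay at distance `a` on a line of length `ℓ`, as the cost
of placing no relay minus the amount saved on lines that are longer than `a`. -/
noncomputable def singleRelayCost (ρ ξ a : ℝ) (s : ActiveState) (ℓ : ℝ) : ℝ :=
  (s.1 * Real.exp (ρ * ℓ) - s.1) - (Set.Ioi a).indicator (fun x =>
    (s.1 - (nextActive ρ s a).1 * Real.exp (-(ρ * a))) * Real.exp (ρ * x) -
      (s.1 * Real.exp (ρ * a) - (nextActive ρ s a).1 + ξ)) ℓ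

theorem singleRelayCost_of_lt {ρ ξ a ℓ : ℝ} (s : ActiveState) (h : a < ℓ) :
    singleRelayCost ρ ξ a s ℓ = ξ + s.1 * (Real.exp (ρ * a) - 1) +
      (nextActive ρ s a).1 * (Real.exp (ρ * (ℓ - a)) - 1) := by
  have he : Real.exp (ρ * (ℓ - a)) = Real.exp (-(ρ * a)) * Real.exp (ρ * ℓ) := by
    rw [← Real.exp_add]; ring_nf
  rw [singleRelayCost, Set.indicator_of_mem (show ℓ ∈ Set.Ioi a from h), he]
  ring

theorem singleRelayCost_of_le {ρ ξ a ℓ : ℝ} (s : ActiveState) (h : ℓ ≤ a) :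
    singleRelayCost ρ ξ a s ℓ = s.1 * (Real.exp (ρ * ℓ) - 1) := by
  rw [singleRelayCost, Set.indicator_of_notMem (show ℓ ∉ Set.Ioi a from not_lt.2 h)]
  ring

theorem mul_exp_sub_one_nonneg {ρ x : ℝ} (hρ : 0 < ρ) (s : ActiveState) (hx : 0 ≤ x) :
    0 ≤ s.1 * (Real.exp (ρ * x) - 1) :=
  mul_nonneg s.2.1.le (sub_nonneg.2 (Real.one_le_exp (by positivity)))

theorem singleRelayCost_nonneg {ρ ξ a ℓ : ℝ} (hρ : 0 < ρ) (hξ : 0 < ξ) (ha : 0 ≤ a)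
    (s : ActiveState) (hℓ : 0 ≤ ℓ) : 0 ≤ singleRelayCost ρ ξ a s ℓ := by
  rcases lt_or_ge a ℓ with h | h
  · rw [singleRelayCost_of_lt s h]
    exact add_nonneg (add_nonneg hξ.le (mul_exp_sub_one_nonneg hρ s ha))
      (mul_exp_sub_one_nonneg hρ _ (sub_nonneg.2 h.le))
  · rw [singleRelayCost_of_le s h]
    exact mul_exp_sub_one_nonneg hρ s hℓ

theorem totalCost_singleRelayPolicy {ρ ξ a ℓ : ℝ} (hρ : 0 < ρ) (hξ : 0 < ξ) (ha : 0 ≤ a)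
    (s : ActiveState) (hℓ : 0 < ℓ) :
    totalCost ρ ξ (singleRelayPolicy a) s ℓ =
      ENNReal.ofReal (singleRelayCost ρ ξ a s ℓ) := by
  by_cases h : a < ℓ
  · have hlt : ENNReal.ofReal a < ENNReal.ofReal ℓ := (ENNReal.ofReal_lt_ofReal_iff hℓ).2 h
    -- The relay is placed at instant 0 and the action ∞ ends the line at instant 1, so only two
    -- costs can be nonzero.
    have hend : ∀ k, (trajectory ρ (singleRelayPolicy a) s ℓ (k + 2)).state = .ended := by
      intro k
      induction k with
      | zero =>
        simp [trajectory, nextState, Config.action, singleRelayPolicy, Config.residual, hlt]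
      | succ k ih =>
        rw [trajectory]
        simp only [ih, nextState]
    rw [totalCost, tsum_eq_sum (s := Finset.range 2)]
    · rw [Finset.sum_range_succ, Finset.sum_range_one]
      have h0 : stageCost ρ ξ (trajectory ρ (singleRelayPolicy a) s ℓ 0).state
          ((trajectory ρ (singleRelayPolicy a) s ℓ 0).action (singleRelayPolicy a))
          ((trajectory ρ (singleRelayPolicy a) s ℓ 0).residual ℓ) =
          ξ + s.1 * (Real.exp (ρ * a) - 1) := by
        simp [trajectory, stageCost, Config.action, singleRelayPolicy, Config.residual, hlt, ha]
      have h1 : stageCost ρ ξ (trajectory ρ (singleRelayPolicy a) s ℓ 1).state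
          ((trajectory ρ (singleRelayPolicy a) s ℓ 1).action (singleRelayPolicy a))
          ((trajectory ρ (singleRelayPolicy a) s ℓ 1).residual ℓ) =
          (nextActive ρ s a).1 * (Real.exp (ρ * (ℓ - a)) - 1) := by
        simp [trajectory, stageCost, nextState, Config.action, singleRelayPolicy,
          Config.residual, hlt, ha, Fin.snoc]
      rw [h0, h1, ← ENNReal.ofReal_add
        (add_nonneg hξ.le (mul_exp_sub_one_nonneg hρ s ha))
        (mul_exp_sub_one_nonneg hρ _ (sub_nonneg.2 h.le)), singleRelayCost_of_lt s h]
    · intro k hk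
      obtain ⟨j, rfl⟩ := Nat.exists_eq_add_of_le' (not_lt.1 (fun h => hk (Finset.mem_range.2 h)))
      simp [hend, stageCost]
  · have hlt : ¬ ENNReal.ofReal a < ENNReal.ofReal ℓ :=
      not_lt.2 (ENNReal.ofReal_le_ofReal (not_lt.1 h))
    have hend : ∀ k, (trajectory ρ (singleRelayPolicy a) s ℓ (k + 1)).state = .ended := by
      intro k
      induction k with
      | zero =>
        simp [trajectory, nextState, Config.action, singleRelayPolicy, Config.residual, hlt]
      | succ k ih =>
        rw [trajectory]
        simp only [ih, nextState]
    rw [totalCost, tsum_eq_single 0]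
    · rw [singleRelayCost_of_le s (not_lt.1 h)]
      simp [trajectory, stageCost, Config.action, singleRelayPolicy, Config.residual, hlt]
    · intro k hk
      obtain ⟨j, rfl⟩ := Nat.exists_eq_succ_of_ne_zero hk
      simp [hend, stageCost]

/-- Finiteness of the density allows an arbitrary `f`, so measurability of `totalCost` is never
needed. -/
theorem lintegral_expMeasure (β : ℝ) (f : ℝ → ℝ≥0∞) :
    ∫⁻ x, f x ∂(expMeasure β) =
      ∫⁻ x in Set.Ioi 0, ENNReal.ofReal (β * Real.exp (-(β * x))) * f x := by
  have h : expMeasure β = volume.withDensity (exponentialPDF β) := rfl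
  have hm : Measurable (exponentialPDF β) :=
    (measurable_exponentialPDFReal β).ennreal_ofReal
  rw [h, lintegral_withDensity_eq_lintegral_mul_non_measurable _ hm
    (Eventually.of_forall fun _ => ENNReal.ofReal_lt_top),
    setLIntegral_congr Ioi_ae_eq_Ici, ← lintegral_indicator measurableSet_Ici]
  refine lintegral_congr fun x => ?_
  by_cases hx : 0 ≤ x
  · rw [Set.indicator_of_mem (show x ∈ Set.Ici 0 from hx), Pi.mul_apply,
      exponentialPDF_of_nonneg hx]
  · rw [Set.indicator_of_notMem (show x ∉ Set.Ici 0 from hx), Pi.mul_apply,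
      exponentialPDF_of_neg (not_le.1 hx), zero_mul]

theorem exponential_density_mul (ρ β K C x : ℝ) :
    β * Real.exp (-(β * x)) * (K * Real.exp (ρ * x) - C) =
      β * K * Real.exp ((ρ - β) * x) - β * C * Real.exp (-β * x) := by
  have h : Real.exp ((ρ - β) * x) = Real.exp (-(β * x)) * Real.exp (ρ * x) := by
    rw [← Real.exp_add]; ring_nf
  rw [h, neg_mul]
  ring

theorem integrableOn_exponential_density_mul {ρ β : ℝ} (hβ₀ : 0 < β) (hβ : ρ < β) (K C c : ℝ) :
    IntegrableOn (fun x => β * Real.exp (-(β * x)) * (K * Real.exp (ρ * x) - C)) (Set.Ioi c) := by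
  simp_rw [exponential_density_mul]
  exact ((integrableOn_exp_mul_Ioi (sub_neg.2 hβ) c).const_mul _).sub
    ((integrableOn_exp_mul_Ioi (neg_neg_of_pos hβ₀) c).const_mul _)

/-- Serves both the cost without relays (K = C = s, c = 0) and the saving due to the relay (c = a).
-/
theorem integral_exponential_density_mul {ρ β : ℝ} (hβ₀ : 0 < β) (hβ : ρ < β) (K C c : ℝ) :
    ∫ x in Set.Ioi c, β * Real.exp (-(β * x)) * (K * Real.exp (ρ * x) - C) =
      Real.exp (-(β * c)) * (β / (β - ρ) * K * Real.exp (ρ * c) - C) := by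
  simp_rw [exponential_density_mul]
  rw [integral_sub ((integrableOn_exp_mul_Ioi (sub_neg.2 hβ) c).const_mul _)
    ((integrableOn_exp_mul_Ioi (neg_neg_of_pos hβ₀) c).const_mul _),
    integral_const_mul, integral_const_mul, integral_exp_mul_Ioi (sub_neg.2 hβ),
    integral_exp_mul_Ioi (neg_neg_of_pos hβ₀)]
  have h : Real.exp ((ρ - β) * c) = Real.exp (-(β * c)) * Real.exp (ρ * c) := by
    rw [← Real.exp_add]; ring_nf
  have h1 : β - ρ ≠ 0 := (sub_pos.2 hβ).ne'
  have h2 : ρ - β ≠ 0 := (sub_neg.2 hβ).ne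
  rw [h, neg_mul, ← neg_sub β ρ]
  field_simp

/-- The expected cost of placing a single relay at distance `a`. -/
theorem expectedCost_singleRelayPolicy {ρ β ξ a : ℝ} (hρ : 0 < ρ) (hβ : ρ < β) (hξ : 0 < ξ)
    (ha : 0 ≤ a) (s : ActiveState) :
    expectedCost ρ β ξ (singleRelayPolicy a) s =
      ENNReal.ofReal (ρ / (β - ρ) * s.1 - Real.exp (-(β * a)) *
        (ρ / (β - ρ) * (s.1 * Real.exp (ρ * a) - (nextActive ρ s a).1) - ξ)) := by
  have hβ₀ : 0 < β := hρ.trans hβ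
  have h1 : β - ρ ≠ 0 := (sub_pos.2 hβ).ne'
  set K : ℝ := s.1 - (nextActive ρ s a).1 * Real.exp (-(ρ * a)) with hK
  set C : ℝ := s.1 * Real.exp (ρ * a) - (nextActive ρ s a).1 + ξ with hC
  set w : ℝ → ℝ → ℝ → ℝ := fun K C x =>
    β * Real.exp (-(β * x)) * (K * Real.exp (ρ * x) - C) with hw
  have hsplit : ∀ x, β * Real.exp (-(β * x)) * singleRelayCost ρ ξ a s x =
      w s.1 s.1 x - (Set.Ioi a).indicator (w K C) x := by
    intro x
    rw [singleRelayCost, mul_sub, hw]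
    simp only [Set.indicator_apply, mul_ite, mul_zero, hK, hC]
  have hint : ∀ K C c, IntegrableOn (w K C) (Set.Ioi c) := fun K C c =>
    integrableOn_exponential_density_mul hβ₀ hβ K C c
  have hind : IntegrableOn ((Set.Ioi a).indicator (w K C)) (Set.Ioi 0) :=
    (hint K C 0).indicator measurableSet_Ioi
  have hsave : ∫ x in Set.Ioi 0, (Set.Ioi a).indicator (w K C) x = ∫ x in Set.Ioi a, w K C x := by
    rw [setIntegral_indicator measurableSet_Ioi,
      Set.inter_eq_right.2 (Set.Ioi_subset_Ioi ha)]
  have hcost : expectedCost ρ β ξ (singleRelayPolicy a) s =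
      ∫⁻ x in Set.Ioi 0, ENNReal.ofReal (w s.1 s.1 x - (Set.Ioi a).indicator (w K C) x) := by
    rw [expectedCost, lintegral_expMeasure]
    refine setLIntegral_congr_fun measurableSet_Ioi fun x hx => ?_
    rw [totalCost_singleRelayPolicy hρ hξ ha s hx, ← ENNReal.ofReal_mul (by positivity), hsplit]
  have hdiff : IntegrableOn (fun x => w s.1 s.1 x - (Set.Ioi a).indicator (w K C) x)
      (Set.Ioi 0) := (hint _ _ 0).sub hind
  rw [hcost, ← ofReal_integral_eq_lintegral_ofReal hdiff, integral_sub (hint _ _ 0) hind, hsave, integral_exponential_density_mul hβ₀ hβ,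
    integral_exponential_density_mul hβ₀ hβ]
  · have h2 : K * Real.exp (ρ * a) = s.1 * Real.exp (ρ * a) - (nextActive ρ s a).1 := by
      rw [hK, sub_mul, mul_assoc, ← Real.exp_add]
      simp
    -- The summand 1 cancels the constants subtracted from the exponentials, leaving θ and ξ.
    have h3 : β / (β - ρ) = 1 + ρ / (β - ρ) := by field_simp; ring
    rw [mul_assoc _ K, h2, h3, hC]
    simp only [mul_zero, neg_zero, Real.exp_zero]
    ring_nf
  · filter_upwards [ae_restrict_mem measurableSet_Ioi] with x hx
    have hx' : 0 ≤ x := le_of_lt hx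
    rw [Pi.zero_apply, ← hsplit]
    exact mul_nonneg (by positivity) (singleRelayCost_nonneg hρ hξ ha s hx')

theorem optimalValue_lt {ρ β ξ : ℝ} (hρ : 0 < ρ) (hβ : ρ < β) (hξ : 0 < ξ) (s : ActiveState) :
    optimalValue ρ β ξ s < ENNReal.ofReal (ρ / (β - ρ) * s.1) := by
  have hs := s.2.1
  have hθ : 0 < ρ / (β - ρ) := div_pos hρ (sub_pos.2 hβ)
  set θ := ρ / (β - ρ)
  have hr : 0 < (1 + ξ / θ) / s.1 := by positivity
  -- Chosen so that se^{ρa} = s + 1 + ξ/θ: ξ/θ pays for the relay, 1 dominates the new state, and s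
  -- leaves a strict gain.
  set a : ℝ := Real.log (1 + (1 + ξ / θ) / s.1) / ρ with ha_def
  have ha : 0 ≤ a := div_nonneg (Real.log_nonneg (by linarith)) hρ.le
  have hexp : s.1 * Real.exp (ρ * a) = s.1 + 1 + ξ / θ := by
    rw [ha_def, mul_div_cancel₀ _ hρ.ne', Real.exp_log (by positivity)]
    field_simp
    ring
  refine (iInf_le _ (singleRelayPolicy a)).trans_lt ?_
  rw [expectedCost_singleRelayPolicy hρ hβ hξ ha,
    ENNReal.ofReal_lt_ofReal_iff (mul_pos hθ hs)]
  refine sub_lt_self _ (mul_pos (Real.exp_pos _) ?_)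
  have hgain : θ * (s.1 * Real.exp (ρ * a) - (nextActive ρ s a).1) - ξ =
      θ * (s.1 + (1 - (nextActive ρ s a).1)) := by
    rw [hexp]
    field_simp
    ring
  rw [hgain]
  exact mul_pos hθ (add_pos_of_pos_of_nonneg hs (sub_nonneg.2 (nextActive ρ s a).2.2))

end RelayPlacement

theorem mainTheorem12 (ρ β ξ : ℝ) (hρ : 0 < ρ) (hβ : ρ < β) (hξ : 0 < ξ) :
    (∀ s : RelayPlacement.ActiveState,
      RelayPlacement.optimalValue ρ β ξ s < ENNReal.ofReal (ρ / (β - ρ) * (s : ℝ))) ∧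
    Tendsto (fun s : RelayPlacement.ActiveState => RelayPlacement.optimalValue ρ β ξ s)
      (comap (fun s : RelayPlacement.ActiveState => (s : ℝ)) (𝓝 0)) (𝓝 0) := by
  refine ⟨fun s => RelayPlacement.optimalValue_lt hρ hβ hξ s, ?_⟩
  have hbound : Tendsto (fun s : RelayPlacement.ActiveState =>
      ENNReal.ofReal (ρ / (β - ρ) * (s : ℝ)))
      (comap (fun s : RelayPlacement.ActiveState => (s : ℝ)) (𝓝 0)) (𝓝 0) := by
    -- As 0 is not an active state, the limit is taken in ℝ and pulled back along the coercion.
    have h : Tendsto (fun x : ℝ => ENNReal.ofReal (ρ / (β - ρ) * x)) (𝓝 0) (𝓝 0) := by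
      have hc : Continuous fun x : ℝ => ENNReal.ofReal (ρ / (β - ρ) * x) :=
        ENNReal.continuous_ofReal.comp (continuous_const.mul continuous_id)
      simpa using hc.tendsto 0
    exact h.comp tendsto_comap
  exact tendsto_of_tendsto_of_tendsto_of_le_of_le tendsto_const_nhds hbound
    (fun _ => zero_le) fun s => (RelayPlacement.optimalValue_lt hρ hβ hξ s).le
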